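/- A signed permutation $\pi=[a_1,\dots,a_n]$ is a sequence of nonzero integers such that $|a_1|,\dots,|a_n|$ are the numbers $1,\dots,n$ in some order. An entry $k$ has the head pointer $(|k|,|k|+1)$ and the tail pointer $(|k|-1,|k|)$. If $k>0$, the tail is placed immediately to the left of $k$ and the head immediately to the right of $k$; if $k<0$, the head is on the left and the tail on the right. Context directed reversal: $\mathbf{cdr}_p$ applies to $\pi$ if the pointer $p$ occurs twice and its two occurrences lie either both to the left or both to the right of their entries (equivalently, the two entries have opposite signs). It reverses the order of the entries in the segment between the two occurrences of $p$ and changes the signs of these entries. Context directed swap: $\mathbf{cds}_{p,q}$ applies to $\pi$ if the pointers $p,q$ occur in the order $p\cdots q\cdots p\cdots q$, where the two entries carrying $p$ have equal signs and the two entries carrying $q$ have equal signs. It exchanges the segment between the first $p$ and the first $q$ with the segment between the second $p$ and the second $q$ (either segment may be empty). A signed permutation is $\mathbf{cdr}$-sortable (respectively $\mathbf{cds}$-sortable) if some finite, possibly empty, sequence of applications of $\mathbf{cdr}$ (respectively $\mathbf{cds}$) transforms it into the identity $[1,2,\dots,n]$. A $\mathbf{cdr}$ fixed point of $\pi$ is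 a signed permutation that is obtained from $\pi$ by a finite, possibly empty, sequence of applications of $\mathbf{cdr}$ and to which no $\mathbf{cdr}$ applies. Theorem (the $\mathbf{cds}$ Rescue Theorem). Let $\pi$ be a $\mathbf{cdr}$-sortable signed permutation. Then every $\mathbf{cdr}$ fixed point of $\pi$ is $\mathbf{cds}$-sortable. -/

import Mathlib

/-! A signed permutation `[a₁, …, aₙ]` is represented by the list of its (integer) entries. -/

/-- `l = [a₁, …, aₙ]` is a signed permutation of `{1, …, n}`: the absolute values of its entries
are the numbers `1, …, n` in some order, each exactly once. -/
def IsSignedPerm (n : ℕ) (l : List ℤ) : Prop :=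
  (l.map Int.natAbs).Perm (List.range' 1 n)

/-- The identity `[1, 2, …, n]`. -/
def identityPerm (n : ℕ) : List ℤ := (List.range' 1 n).map (fun k : ℕ => (k : ℤ))

/-- The head pointer `(|k|, |k| + 1)` of an entry `k`. -/
def headPointer (k : ℤ) : ℤ × ℤ := (|k|, |k| + 1)

/-- The tail pointer `(|k| - 1, |k|)` of an entry `k`. -/
def tailPointer (k : ℤ) : ℤ × ℤ := (|k| - 1, |k|)

/-- The pointer written immediately to the left of an entry `k`: the tail if `k` is positive, the
head if `k` is negative. -/
def leftPointer (k : ℤ) : ℤ × ℤ := if 0 < k then tailPointer k else headPointer k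

/-- The pointer written immediately to the right of an entry `k`: the head if `k` is positive, the
tail if `k` is negative. -/
def rightPointer (k : ℤ) : ℤ × ℤ := if 0 < k then headPointer k else tailPointer k

/-- The segment `S` is nonempty and starts with an occurrence of the pointer `p`, located to the
left of its first entry. -/
def StartsWith (p : ℤ × ℤ) (S : List ℤ) : Prop := ∃ x B, S = x :: B ∧ leftPointer x = p

/-- The segment `S` is nonempty and ends with an occurrence of the pointer `p`, located to the
right of its last entry. -/
def EndsWith (p : ℤ × ℤ) (S : List ℤ) : Prop := ∃ B x, S = B ++ [x] ∧ rightPointer x = p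

/-- Reverse the order of the entries of a segment and change all their signs. -/
def reverseNeg (S : List ℤ) : List ℤ := (S.map (fun k => -k)).reverse

/-- `Cdr p α β`: the context directed reversal at the pointer `p` applies to `α` and yields `β`.
Either both occurrences of `p` are at the left of their entries, or both are at the right (that is,
the two entries have opposite signs); the segment `S` between the two occurrences is reversed, and
the signs of its entries are changed. -/
inductive Cdr (p : ℤ × ℤ) : List ℤ → List ℤ → Prop
  | left (A S C : List ℤ) (h₁ : StartsWith p S) (h₂ : StartsWith p C) :
      Cdr p (A ++ S ++ C) (A ++ reverseNeg S ++ C)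
  | right (A S C : List ℤ) (h₁ : EndsWith p A) (h₂ : EndsWith p S) :
      Cdr p (A ++ S ++ C) (A ++ reverseNeg S ++ C)

/-- `Cds p q α β`: the context directed swap at the pointers `p`, `q` applies to `α` and yields
`β`. The occurrences of `p` and `q` appear in the order `p … q … p … q`, and the segment `S` between
the first `p` and the first `q` is exchanged with the segment `T` between the second `p` and the
second `q`. The four constructors correspond to the possible sides of the entries on which the
first occurrences of `p` and `q` are located. In each of them the two entries that carry `p` have
equal signs, and so have the two entries that carry `q`. A segment without a condition on
it may be empty. -/
inductive Cds (p q : ℤ × ℤ) : List ℤ → List ℤ → Prop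
  | left_right (A S M T C : List ℤ) (h₁ : StartsWith p S) (h₂ : EndsWith q S)
      (h₃ : EndsWith p M) (h₄ : StartsWith q C) :
      Cds p q (A ++ S ++ M ++ T ++ C) (A ++ T ++ M ++ S ++ C)
  | right_right (A S M T C : List ℤ) (h₁ : EndsWith p A) (h₂ : EndsWith q S)
      (h₃ : StartsWith p T) (h₄ : StartsWith q C) :
      Cds p q (A ++ S ++ M ++ T ++ C) (A ++ T ++ M ++ S ++ C)
  | right_left (A S M T C : List ℤ) (h₁ : EndsWith p A) (h₂ : StartsWith q M)
      (h₃ : StartsWith p T) (h₄ : EndsWith q T) :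
      Cds p q (A ++ S ++ M ++ T ++ C) (A ++ T ++ M ++ S ++ C)
  | left_left (A S M T C : List ℤ) (h₁ : StartsWith p S) (h₂ : StartsWith q M)
      (h₃ : EndsWith p M) (h₄ : EndsWith q T) :
      Cds p q (A ++ S ++ M ++ T ++ C) (A ++ T ++ M ++ S ++ C)

/-- One application of some context directed reversal. -/
def CdrStep (α β : List ℤ) : Prop := ∃ p, Cdr p α β

/-- One application of some context directed swap. -/
def CdsStep (α β : List ℤ) : Prop := ∃ p q, Cds p q α β

/-- `α` can be transformed into the identity of `{1, …, n}` by finitely many (possibly zero)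
context directed reversals. -/
def CdrSortable (n : ℕ) (α : List ℤ) : Prop :=
  Relation.ReflTransGen CdrStep α (identityPerm n)

/-- `α` can be transformed into the identity of `{1, …, n}` by finitely many (possibly zero)
context directed swaps. -/
def CdsSortable (n : ℕ) (α : List ℤ) : Prop :=
  Relation.ReflTransGen CdsStep α (identityPerm n)

/-- `β` is a `cdr` fixed point of `α`: it is obtained from `α` by finitely many (possibly zero)
context directed reversals, and no context directed reversal applies to it. -/
def IsCdrFixedPointOf (β α : List ℤ) : Prop :=
  Relation.ReflTransGen CdrStep α β ∧ ∀ p γ, ¬ Cdr p β γ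

/-! ### Preliminaries on pointers and signed permutations -/

/-! Frame a signed permutation by entries 0 and n + 1, so that (0,1) also stands at its left end and
(n,n+1) at its right end. Join pointers that face each other at a junction and identify the two
occurrences of each pointer. A coloring in the sense of `Colors` is constant on the resulting
cycles, and `Separable` says that (0,1) and (n,n+1) lie on different cycles.

Separability is invariant under reversals in both directions: forwards (`Colors.cdr`) the same
coloring works, backwards (`Separable.of_cdr`) only the pointer used must be recolored. The identity
is separable for n ≥ 1, hence so is every sortable permutation and each of its fixed points.

At a fixed point consecutive values have equal signs, so all entries have the same sign. All
negative is incompatible with separability by a count of colors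
(`IsSignedPerm.not_separable_of_neg`). If all are positive, swaps grow a block [1, …, k] one value
at a time (`exists_extend_block`). The only obstruction is k + 1 in first position with the block at
the very end; then both ends carry the color of (k, k + 1), which separability forbids. Swaps
preserve the coloring (`Colors.cds`), so the growth continues to the identity. -/

lemma leftPointer_neg {x : ℤ} (hx : x ≠ 0) : leftPointer (-x) = rightPointer x := by
  unfold leftPointer rightPointer headPointer tailPointer
  rcases lt_or_gt_of_ne hx with h | h
  · simp [h, not_lt.2 h.le]
  · simp [h, not_lt.2 h.le]

lemma rightPointer_neg {x : ℤ} (hx : x ≠ 0) : rightPointer (-x) = leftPointer x := by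
  have := leftPointer_neg (neg_ne_zero.2 hx)
  rw [neg_neg] at this
  exact this.symm

lemma leftPointer_of_pos {x : ℤ} (hx : 0 < x) : leftPointer x = (x - 1, x) := by
  simp [leftPointer, tailPointer, hx, abs_of_pos hx]

lemma rightPointer_of_pos {x : ℤ} (hx : 0 < x) : rightPointer x = (x, x + 1) := by
  simp [rightPointer, headPointer, hx, abs_of_pos hx]

lemma reverseNeg_cons (x : ℤ) (S : List ℤ) : reverseNeg (x :: S) = reverseNeg S ++ [-x] := by
  simp [reverseNeg]

lemma IsSignedPerm.mem_iff {n : ℕ} {l : List ℤ} (h : IsSignedPerm n l) (k : ℕ) :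
    (∃ x ∈ l, x.natAbs = k) ↔ 1 ≤ k ∧ k ≤ n := by
  have : k ∈ l.map Int.natAbs ↔ k ∈ List.range' 1 n := List.Perm.mem_iff h
  simp only [List.mem_map, List.mem_range'_1] at this
  rw [this]
  omega

lemma IsSignedPerm.bounds {n : ℕ} {l : List ℤ} (h : IsSignedPerm n l) {x : ℤ} (hx : x ∈ l) :
    1 ≤ x.natAbs ∧ x.natAbs ≤ n :=
  (h.mem_iff _).1 ⟨x, hx, rfl⟩

lemma IsSignedPerm.ne_zero {n : ℕ} {l : List ℤ} (h : IsSignedPerm n l) {x : ℤ} (hx : x ∈ l) :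
    x ≠ 0 := by
  have := h.bounds hx
  omega

lemma IsSignedPerm.nodup_natAbs {n : ℕ} {l : List ℤ} (h : IsSignedPerm n l) :
    (l.map Int.natAbs).Nodup :=
  h.nodup_iff.2 List.nodup_range'

lemma map_natAbs_reverseNeg (S : List ℤ) :
    ((reverseNeg S).map Int.natAbs).Perm (S.map Int.natAbs) := by
  have : (reverseNeg S).map Int.natAbs = (S.map Int.natAbs).reverse := by
    simp [reverseNeg, Function.comp_def]
  rw [this]
  exact List.reverse_perm _

lemma Cdr.map_natAbs_perm {p : ℤ × ℤ} {α β : List ℤ} (h : Cdr p α β) :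
    (β.map Int.natAbs).Perm (α.map Int.natAbs) := by
  cases h <;>
  · simp only [List.map_append]
    exact ((map_natAbs_reverseNeg _).append_left _).append_right _

lemma IsSignedPerm.cdr {n : ℕ} {p : ℤ × ℤ} {α β : List ℤ} (hα : IsSignedPerm n α)
    (h : Cdr p α β) : IsSignedPerm n β :=
  h.map_natAbs_perm.trans hα

/-- The pointers written in a list of entries, from left to right. -/
def pointers (l : List ℤ) : List (ℤ × ℤ) := l.flatMap fun x => [leftPointer x, rightPointer x]

lemma pointers_perm (l : List ℤ) :
    (pointers l).Perm (l.map headPointer ++ l.map tailPointer) := by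
  induction l with
  | nil => simp [pointers]
  | cons x l ih =>
    have h : (pointers (x :: l)).Perm (headPointer x :: tailPointer x :: pointers l) := by
      by_cases hx : 0 < x
      · simpa [pointers, leftPointer, rightPointer, hx] using List.Perm.swap _ _ _
      · simp [pointers, leftPointer, rightPointer, hx]
    refine h.trans ?_
    simp only [List.map_cons, List.cons_append]
    refine List.Perm.cons _ (((ih.cons _)).trans ?_)
    exact List.perm_middle.symm

/-- Including the two pointers at the ends of the permutation, no pointer occurs more than twice. -/
lemma IsSignedPerm.count_pointers_le {n : ℕ} {l : List ℤ} (h : IsSignedPerm n l) (p : ℤ × ℤ) :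
    ((0, 1) :: ((n : ℤ), (n : ℤ) + 1) :: pointers l).count p ≤ 2 := by
  -- The added pointers are the head of 0 and the tail of n + 1. Heads are pairwise distinct, and so
  -- are tails, whence the bound 1 + 1.
  have hperm : ((0, 1) :: ((n : ℤ), (n : ℤ) + 1) :: pointers l).Perm
      (((0, 1) :: l.map headPointer) ++ (((n : ℤ), (n : ℤ) + 1) :: l.map tailPointer)) := by
    rw [List.cons_append]
    exact (((pointers_perm l).cons _).trans List.perm_middle.symm).cons _
  have hnd := h.nodup_natAbs
  have hheads : ((0, 1) :: l.map headPointer).Nodup := by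
    refine List.nodup_cons.2 ⟨?_, ?_⟩
    · simp only [List.mem_map, not_exists, not_and]
      intro x hx hx'
      have := h.ne_zero hx
      simp [headPointer] at hx'
      exact this hx'
    · refine List.Nodup.of_map (fun q : ℤ × ℤ => q.1.natAbs) ?_
      simpa [Function.comp_def, headPointer, Int.natAbs_abs] using hnd
  have htails : (((n : ℤ), (n : ℤ) + 1) :: l.map tailPointer).Nodup := by
    refine List.nodup_cons.2 ⟨?_, ?_⟩
    · simp only [List.mem_map, not_exists, not_and]
      intro x hx hx'
      have := h.bounds hx
      simp only [tailPointer, Prod.mk.injEq, Int.abs_eq_natAbs] at hx'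
      omega
    · refine List.Nodup.of_map (fun q : ℤ × ℤ => q.2.natAbs) ?_
      simpa [Function.comp_def, tailPointer, Int.natAbs_abs] using hnd
  rw [hperm.count_eq, List.count_append]
  have h₁ := List.nodup_iff_count_le_one.1 hheads p
  have h₂ := List.nodup_iff_count_le_one.1 htails p
  omega

/-! ### Colorings of the pointers -/

/-- `Colors X s l t`: the coloring `X` of the pointers gives equal colors to any two pointers that
face each other in `l`, the color `s` to the leftmost pointer and the color `t` to the rightmost
one. -/
def Colors (X : ℤ × ℤ → Bool) : Bool → List ℤ → Bool → Prop
  | s, [], t => s = t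
  | s, x :: l, t => s = X (leftPointer x) ∧ Colors X (X (rightPointer x)) l t

lemma colors_append {X : ℤ × ℤ → Bool} {s t : Bool} {l m : List ℤ} :
    Colors X s (l ++ m) t ↔ ∃ u, Colors X s l u ∧ Colors X u m t := by
  induction l generalizing s with
  | nil => simp [Colors]
  | cons x l ih => simp [Colors, ih, and_assoc]

/-- Negation exchanges the left and right pointers of an entry, so the reversed segment shows the
same pointers read backwards. -/
lemma colors_reverseNeg {X : ℤ × ℤ → Bool} {s t : Bool} {l : List ℤ} (hl : ∀ x ∈ l, x ≠ 0) :
    Colors X s (reverseNeg l) t ↔ Colors X t l s := by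
  induction l generalizing t with
  | nil => simp [Colors, reverseNeg, eq_comm]
  | cons x l ih =>
    have hx := hl x (by simp)
    rw [reverseNeg_cons, colors_append]
    simp only [leftPointer_neg hx, rightPointer_neg hx,
      ih fun y hy => hl y (by simp [hy]), Colors]
    constructor
    · rintro ⟨u, h, rfl, rfl⟩
      exact ⟨rfl, h⟩
    · rintro ⟨rfl, h⟩
      exact ⟨_, h, rfl, rfl⟩

lemma Colors.congr {X Y : ℤ × ℤ → Bool} {s t : Bool} {l : List ℤ} (h : Colors X s l t)
    (hXY : ∀ q ∈ pointers l, X q = Y q) : Colors Y s l t := by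
  induction l generalizing s with
  | nil => exact h
  | cons x l ih =>
    obtain ⟨h₁, h₂⟩ := h
    simp only [pointers, List.flatMap_cons, List.mem_append, List.mem_cons,
      List.not_mem_nil, or_false] at hXY
    refine ⟨h₁.trans (hXY _ (by simp)), ?_⟩
    rw [← hXY _ (Or.inl (Or.inr rfl))]
    exact ih h₂ fun q hq => hXY q (Or.inr hq)

lemma Colors.update {X : ℤ × ℤ → Bool} {s t c : Bool} {l : List ℤ} {p : ℤ × ℤ}
    (h : Colors X s l t) (hp : p ∉ pointers l) : Colors (Function.update X p c) s l t :=
  h.congr fun q hq => by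
    rw [Function.update_of_ne]
    rintro rfl
    exact hp hq

lemma Colors.startsWith {X : ℤ × ℤ → Bool} {s t : Bool} {l : List ℤ} {p : ℤ × ℤ}
    (h : Colors X s l t) (hp : StartsWith p l) : s = X p := by
  obtain ⟨x, B, rfl, rfl⟩ := hp
  exact h.1

lemma Colors.endsWith {X : ℤ × ℤ → Bool} {s t : Bool} {l : List ℤ} {p : ℤ × ℤ}
    (h : Colors X s l t) (hp : EndsWith p l) : t = X p := by
  obtain ⟨B, x, rfl, rfl⟩ := hp
  obtain ⟨u, -, h⟩ := colors_append.1 h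
  exact h.2.symm

/-- At each junction the right pointer and the next left pointer have the same color; only the two
ends remain unmatched. -/
lemma Colors.count {X : ℤ × ℤ → Bool} {s t : Bool} {l : List ℤ} (h : Colors X s l t) :
    s.toNat + (l.map fun x => (X (rightPointer x)).toNat).sum =
      (l.map fun x => (X (leftPointer x)).toNat).sum + t.toNat := by
  induction l generalizing s with
  | nil =>
    have : s = t := h
    simp [this]
  | cons x l ih =>
    obtain ⟨rfl, h₂⟩ := h
    have := ih h₂
    simp only [List.map_cons, List.sum_cons]
    omega

/-- Both ends of the reversed segment have the color of p, so the segment can be turned around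
without recoloring. -/
lemma Colors.cdr {X : ℤ × ℤ → Bool} {s t : Bool} {p : ℤ × ℤ} {α β : List ℤ}
    (h : Colors X s α t) (hα : ∀ x ∈ α, x ≠ 0) (hc : Cdr p α β) : Colors X s β t := by
  have key : ∀ A S C : List ℤ, (∀ x ∈ A ++ S ++ C, x ≠ 0) →
      (∃ v, (∃ u, Colors X s A u ∧ Colors X u S v ∧ u = v) ∧ Colors X v C t) →
      Colors X s (A ++ reverseNeg S ++ C) t := by
    rintro A S C h0 ⟨v, ⟨u, h₁, h₂, rfl⟩, h₃⟩
    refine colors_append.2 ⟨u, colors_append.2 ⟨u, h₁, ?_⟩, h₃⟩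
    exact (colors_reverseNeg fun x hx => h0 x (by simp [hx])).2 h₂
  cases hc with
  | left A S C hS hC =>
    obtain ⟨v, h, h₃⟩ := colors_append.1 h
    obtain ⟨u, h₁, h₂⟩ := colors_append.1 h
    exact key A S C hα ⟨v, ⟨u, h₁, h₂, (h₂.startsWith hS).trans (h₃.startsWith hC).symm⟩, h₃⟩
  | right A S C hA hS =>
    obtain ⟨v, h, h₃⟩ := colors_append.1 h
    obtain ⟨u, h₁, h₂⟩ := colors_append.1 h
    exact key A S C hα ⟨v, ⟨u, h₁, h₂, (h₁.endsWith hA).trans (h₂.endsWith hS).symm⟩, h₃⟩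

/-- Some coloring separates the two end pointers of `l`, with the left end of `l` colored like
`(0, 1)` and the right end like `(n, n + 1)`. -/
def Separable (n : ℕ) (l : List ℤ) : Prop :=
  ∃ X : ℤ × ℤ → Bool, X (0, 1) = true ∧ X (n, n + 1) = false ∧ Colors X true l false

/-- After the reversal the two occurrences of p face each other, so p is a cycle by itself and its
color is free. Undoing the reversal inserts p into another cycle, whose color it must take. Since p
already occurs twice in the list, it is neither end pointer. -/
lemma Separable.of_cdr {n : ℕ} {p : ℤ × ℤ} {α β : List ℤ} (hα : IsSignedPerm n α)
    (hc : Cdr p α β) (h : Separable n β) : Separable n α := by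
  obtain ⟨X, h0, hn, hX⟩ := h
  have hne : ∀ x ∈ α, x ≠ 0 := fun x hx => hα.ne_zero hx
  have hcount := hα.count_pointers_le p
  cases hc with
  | left A S C hS hC =>
    obtain ⟨x, B, rfl, hx⟩ := hS
    obtain ⟨y, D, rfl, hy⟩ := hC
    simp only [pointers, List.flatMap_append, List.flatMap_cons, List.count_cons,
      List.count_append, hx, hy, beq_self_eq_true, if_true] at hcount
    obtain ⟨v, h, h₃⟩ := colors_append.1 hX
    obtain ⟨u, h₁, h₂⟩ := colors_append.1 h
    rw [colors_reverseNeg fun z hz => hne z (by simp only [List.mem_append]; tauto)] at h₂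
    -- In `β`, p faces itself between the reversed segment and `C`; the color to adopt is the one at
    -- the other end, between `A` and the segment.
    refine ⟨Function.update X p u, ?_, ?_, ?_⟩
    · rw [Function.update_of_ne, h0]
      rintro rfl
      simp at hcount
      omega
    · rw [Function.update_of_ne, hn]
      rintro rfl
      simp at hcount
      omega
    · have hxp : rightPointer x ≠ p := by
        rintro h
        simp [h] at hcount
        omega
      have hyp : rightPointer y ≠ p := by
        rintro h
        simp [h] at hcount
        omega
      have hA : p ∉ pointers A := by
        rw [← List.count_eq_zero, pointers]
        omega
      have hB : p ∉ pointers B := by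
        rw [← List.count_eq_zero, pointers]
        omega
      have hD : p ∉ pointers D := by
        rw [← List.count_eq_zero, pointers]
        omega
      refine colors_append.2 ⟨u, colors_append.2 ⟨u, h₁.update hA, ?_, ?_⟩, ?_, ?_⟩
      · simp [hx]
      · rw [Function.update_of_ne hxp]
        exact h₂.2.update hB
      · simp [hy]
      · rw [Function.update_of_ne hyp]
        exact h₃.2.update hD
  | right A S C hA hS =>
    obtain ⟨A, x, rfl, hx⟩ := hA
    obtain ⟨S, y, rfl, hy⟩ := hS
    simp only [pointers, List.flatMap_append, List.flatMap_cons, List.flatMap_nil, List.count_cons,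
      List.count_append, hx, hy, beq_self_eq_true, if_true] at hcount
    obtain ⟨v, h, h₃⟩ := colors_append.1 hX
    obtain ⟨w, h₁, h₂⟩ := colors_append.1 h
    rw [colors_reverseNeg fun z hz => hne z (by simp only [List.mem_append] at hz ⊢; tauto)] at h₂
    obtain ⟨u₁, h₁, rfl, -⟩ := colors_append.1 h₁
    obtain ⟨u₂, h₂, rfl, -⟩ := colors_append.1 h₂
    -- Mirror image: p faces itself after `A`, so the color to adopt is the one just before `C`.
    refine ⟨Function.update X p v, ?_, ?_, ?_⟩
    · rw [Function.update_of_ne, h0]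
      rintro rfl
      simp at hcount
      omega
    · rw [Function.update_of_ne, hn]
      rintro rfl
      simp at hcount
      omega
    · have hxp : leftPointer x ≠ p := by
        rintro h
        simp [h] at hcount
        omega
      have hyp : leftPointer y ≠ p := by
        rintro h
        simp [h] at hcount
        omega
      have hA : p ∉ pointers A := by
        rw [← List.count_eq_zero, pointers]
        omega
      have hS : p ∉ pointers S := by
        rw [← List.count_eq_zero, pointers]
        omega
      have hC : p ∉ pointers C := by
        rw [← List.count_eq_zero, pointers]
        omega
      refine colors_append.2 ⟨v, colors_append.2 ⟨v, colors_append.2 ⟨_, h₁.update hA, ?_, ?_⟩,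
        colors_append.2 ⟨_, h₂.update hS, ?_, ?_⟩⟩, h₃.update hC⟩
      · rw [Function.update_of_ne hxp]
      · simp [hx, Colors]
      · rw [Function.update_of_ne hyp]
      · simp [hy, Colors]

lemma separable_identityPerm {n : ℕ} (hn : 1 ≤ n) : Separable n (identityPerm n) := by
  have key : ∀ m k : ℕ, 1 ≤ k →
      Colors (fun p => decide (p = (0, 1))) false
        ((List.range' (k + 1) m).map fun k : ℕ => (k : ℤ)) false := by
    intro m
    induction m with
    | zero => simp [Colors]
    | succ m ih =>
      intro k hk
      rw [List.range'_succ, List.map_cons]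
      refine ⟨?_, ?_⟩
      · rw [leftPointer_of_pos (by positivity)]
        simp
        omega
      · rw [rightPointer_of_pos (by positivity)]
        convert ih (k + 1) (by omega)
        simp
        omega
  refine ⟨fun p => decide (p = (0, 1)), by simp, by simp; omega, ?_⟩
  obtain ⟨m, rfl⟩ := Nat.exists_eq_add_of_le' hn
  rw [identityPerm, List.range'_succ, List.map_cons]
  refine ⟨by simp [leftPointer_of_pos], ?_⟩
  rw [rightPointer_of_pos (by simp)]
  convert key m 1 le_rfl
  simp

/-! ### Fixed points of context directed reversals -/

lemma exists_append_of_mem_of_ne {l : List ℤ} {x y : ℤ} (hx : x ∈ l) (hy : y ∈ l) (hxy : x ≠ y) :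
    ∃ A B C, l = A ++ x :: B ++ y :: C ∨ l = A ++ y :: B ++ x :: C := by
  obtain ⟨A, C, rfl⟩ := List.append_of_mem hx
  rcases List.mem_append.1 hy with h | h
  · obtain ⟨A, B, rfl⟩ := List.append_of_mem h
    exact ⟨A, B, C, Or.inr rfl⟩
  · obtain ⟨B, C, rfl⟩ := List.append_of_mem (List.mem_of_ne_of_mem hxy.symm h)
    exact ⟨A, B, C, Or.inl (by simp)⟩

lemma exists_cdr_of_leftPointer_eq {l : List ℤ} {x y : ℤ} (hx : x ∈ l) (hy : y ∈ l) (hxy : x ≠ y)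
    (h : leftPointer x = leftPointer y) : ∃ p γ, Cdr p l γ := by
  obtain ⟨A, B, C, rfl | rfl⟩ := exists_append_of_mem_of_ne hx hy hxy
  · exact ⟨_, _, Cdr.left A (x :: B) (y :: C) ⟨x, B, rfl, rfl⟩ ⟨y, C, rfl, h.symm⟩⟩
  · exact ⟨_, _, Cdr.left A (y :: B) (x :: C) ⟨y, B, rfl, rfl⟩ ⟨x, C, rfl, h⟩⟩

lemma exists_cdr_of_rightPointer_eq {l : List ℤ} {x y : ℤ} (hx : x ∈ l) (hy : y ∈ l) (hxy : x ≠ y)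
    (h : rightPointer x = rightPointer y) : ∃ p γ, Cdr p l γ := by
  obtain ⟨A, B, C, rfl | rfl⟩ := exists_append_of_mem_of_ne hx hy hxy
  · have : A ++ x :: B ++ y :: C = (A ++ [x]) ++ (B ++ [y]) ++ C := by simp
    rw [this]
    exact ⟨_, _, Cdr.right _ _ C ⟨A, x, rfl, rfl⟩ ⟨B, y, rfl, h.symm⟩⟩
  · have : A ++ y :: B ++ x :: C = (A ++ [y]) ++ (B ++ [x]) ++ C := by simp
    rw [this]
    exact ⟨_, _, Cdr.right _ _ C ⟨A, y, rfl, rfl⟩ ⟨B, x, rfl, h⟩⟩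

/-- Entries of consecutive absolute values share a pointer; with opposite signs it lies on the same
side of both, and a reversal applies. -/
lemma pos_iff_pos_of_forall_not_cdr {l : List ℤ} (hfix : ∀ p γ, ¬ Cdr p l γ) {x y : ℤ}
    (hx : x ∈ l) (hy : y ∈ l) (hxy : y.natAbs = x.natAbs + 1) : 0 < x ↔ 0 < y := by
  have hne : x ≠ y := by
    rintro rfl
    omega
  by_contra hcon
  have hyx : |y| = |x| + 1 := by
    rw [Int.abs_eq_natAbs, Int.abs_eq_natAbs]
    omega
  by_cases h : 0 < x
  · have h' : ¬ 0 < y := by tauto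
    obtain ⟨p, γ, hc⟩ := exists_cdr_of_rightPointer_eq hx hy hne
      (by simp [rightPointer, h, h', headPointer, tailPointer, hyx])
    exact hfix p γ hc
  · have h' : 0 < y := by tauto
    obtain ⟨p, γ, hc⟩ := exists_cdr_of_leftPointer_eq hx hy hne
      (by simp [leftPointer, h, h', headPointer, tailPointer, hyx])
    exact hfix p γ hc

lemma IsSignedPerm.pos_iff_pos_of_forall_not_cdr {n : ℕ} {l : List ℤ} (hl : IsSignedPerm n l)
    (hfix : ∀ p γ, ¬ Cdr p l γ) {x : ℤ} (hx : x ∈ l) (hx1 : x.natAbs = 1) :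
    ∀ k : ℕ, ∀ y ∈ l, y.natAbs = k + 1 → (0 < x ↔ 0 < y) := by
  intro k
  induction k with
  | zero =>
    intro y hy hyk
    have : x = y := List.inj_on_of_nodup_map hl.nodup_natAbs hx hy (by omega)
    rw [this]
  | succ k ih =>
    intro y hy hyk
    have := hl.bounds hy
    obtain ⟨z, hz, hzk⟩ := (hl.mem_iff (k + 1)).2 (by omega)
    exact (ih z hz hzk).trans
      (_root_.pos_iff_pos_of_forall_not_cdr hfix hz hy (by omega))

/-- For negative entries the right pointers are (k-1,k) and the left ones (k,k+1), so the numbers of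
true right and left pointers differ by 1 - 0 = 1. `Colors.count` demands a difference of -1. -/
lemma IsSignedPerm.not_separable_of_neg {n : ℕ} {l : List ℤ} (hl : IsSignedPerm n l)
    (hneg : ∀ x ∈ l, x < 0) : ¬ Separable n l := by
  rintro ⟨X, h0, hn, hX⟩
  have hcount := hX.count
  let f : ℕ → ℕ := fun k => (X (k, k + 1)).toNat
  have hright : (l.map fun x => (X (rightPointer x)).toNat).sum =
      ((List.range' 1 n).map fun k => f (k - 1)).sum := by
    rw [← (List.Perm.map _ hl).sum_eq, List.map_map]
    congr 1
    refine List.map_congr_left fun x hx => ?_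
    have h1 := hneg x hx
    have : rightPointer x = (((x.natAbs - 1 : ℕ) : ℤ), ((x.natAbs - 1 : ℕ) : ℤ) + 1) := by
      simp only [rightPointer, not_lt.2 h1.le, if_false, tailPointer, Prod.mk.injEq,
        Int.abs_eq_natAbs]
      omega
    simp only [Function.comp, f, this]
  have hleft : (l.map fun x => (X (leftPointer x)).toNat).sum =
      ((List.range' 1 n).map f).sum := by
    rw [← (List.Perm.map _ hl).sum_eq, List.map_map]
    congr 1
    refine List.map_congr_left fun x hx => ?_
    have h1 := hneg x hx
    have : leftPointer x = ((x.natAbs : ℤ), (x.natAbs : ℤ) + 1) := by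
      simp only [leftPointer, not_lt.2 h1.le, if_false, headPointer, Int.abs_eq_natAbs]
    simp only [Function.comp, f, this]
  have htel : ∀ m : ℕ, ((List.range' 1 m).map f).sum + f 0 =
      ((List.range' 1 m).map fun k => f (k - 1)).sum + f m := by
    intro m
    induction m with
    | zero => simp
    | succ m ih =>
      rw [List.range'_1_concat]
      simp only [List.map_append, List.sum_append, List.map_cons, List.map_nil, List.sum_cons,
        List.sum_nil, Nat.add_comm 1 m, Nat.add_sub_cancel]
      omega
  have h := htel n
  have hf0 : f 0 = 1 := by simp [f, h0]
  have hfn : f n = 0 := by simp [f, hn]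
  rw [hright, hleft] at hcount
  simp only [Bool.toNat_true, Bool.toNat_false] at hcount
  omega

/-! ### Sorting positive permutations by context directed swaps -/

lemma Cds.perm {p q : ℤ × ℤ} {α β : List ℤ} (h : Cds p q α β) : β.Perm α := by
  have key : ∀ A S M T C : List ℤ, (A ++ T ++ M ++ S ++ C).Perm (A ++ S ++ M ++ T ++ C) := by
    intro A S M T C
    rw [← Multiset.coe_eq_coe]
    simp only [← Multiset.coe_add]
    abel
  cases h <;> exact key _ _ _ _ _

/-- Both exchanged segments run from the color of p to the color of q, hence are interchangeable. -/
lemma Colors.cds {X : ℤ × ℤ → Bool} {s t : Bool} {p q : ℤ × ℤ} {α β : List ℤ}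
    (h : Colors X s α t) (hc : Cds p q α β) : Colors X s β t := by
  have key : ∀ A S M T C : List ℤ, Colors X s (A ++ S ++ M ++ T ++ C) t →
      (∀ u v w z, Colors X s A u → Colors X u S v → Colors X v M w → Colors X w T z →
        Colors X z C t → u = w ∧ v = z) → Colors X s (A ++ T ++ M ++ S ++ C) t := by
    intro A S M T C h huv
    obtain ⟨z, h, hC⟩ := colors_append.1 h
    obtain ⟨w, h, hT⟩ := colors_append.1 h
    obtain ⟨v, h, hM⟩ := colors_append.1 h
    obtain ⟨u, hA, hS⟩ := colors_append.1 h
    obtain ⟨rfl, rfl⟩ := huv u v w z hA hS hM hT hC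
    exact colors_append.2 ⟨v, colors_append.2 ⟨u, colors_append.2 ⟨v, colors_append.2
      ⟨u, hA, hT⟩, hM⟩, hS⟩, hC⟩
  cases hc with
  | left_right A S M T C h₁ h₂ h₃ h₄ =>
    exact key A S M T C h fun u v w z hA hS hM hT hC =>
      ⟨(hS.startsWith h₁).trans (hM.endsWith h₃).symm,
        (hS.endsWith h₂).trans (hC.startsWith h₄).symm⟩
  | right_right A S M T C h₁ h₂ h₃ h₄ =>
    exact key A S M T C h fun u v w z hA hS hM hT hC =>
      ⟨(hA.endsWith h₁).trans (hT.startsWith h₃).symm,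
        (hS.endsWith h₂).trans (hC.startsWith h₄).symm⟩
  | right_left A S M T C h₁ h₂ h₃ h₄ =>
    exact key A S M T C h fun u v w z hA hS hM hT hC =>
      ⟨(hA.endsWith h₁).trans (hT.startsWith h₃).symm,
        (hM.startsWith h₂).trans (hT.endsWith h₄).symm⟩
  | left_left A S M T C h₁ h₂ h₃ h₄ =>
    exact key A S M T C h fun u v w z hA hS hM hT hC =>
      ⟨(hS.startsWith h₁).trans (hM.endsWith h₃).symm,
        (hM.startsWith h₂).trans (hT.endsWith h₄).symm⟩

lemma startsWith_cons {x : ℤ} (hx : 0 < x) (B : List ℤ) : StartsWith (x - 1, x) (x :: B) :=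
  ⟨x, B, rfl, leftPointer_of_pos hx⟩

lemma endsWith_append_singleton {x : ℤ} (hx : 0 < x) (B : List ℤ) :
    EndsWith (x, x + 1) (B ++ [x]) :=
  ⟨B, x, rfl, rightPointer_of_pos hx⟩

lemma identityPerm_succ (k : ℕ) : identityPerm (k + 1) = identityPerm k ++ [(k : ℤ) + 1] := by
  rw [identityPerm, List.range'_1_concat, identityPerm]
  simp [add_comm]

lemma mem_identityPerm {n : ℕ} {x : ℤ} : x ∈ identityPerm n ↔ 1 ≤ x ∧ x ≤ n := by
  simp only [identityPerm, List.mem_map, List.mem_range'_1]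
  constructor
  · rintro ⟨k, hk, rfl⟩
    omega
  · intro h
    exact ⟨x.toNat, by omega, by omega⟩

lemma nodup_identityPerm (n : ℕ) : (identityPerm n).Nodup :=
  (List.nodup_range' (s := 1) (n := n)).map Nat.cast_injective

/-- An element of a list of integers that does not contain its predecessor. -/
lemma exists_mem_pred_notMem {S : List ℤ} (hS : S ≠ []) : ∃ x ∈ S, x - 1 ∉ S := by
  obtain ⟨x, hx, hmin⟩ := S.toFinset.exists_min_image id
    (by simpa [Finset.nonempty_iff_ne_empty] using hS)
  refine ⟨x, by simpa using hx, fun h => ?_⟩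
  have := hmin (x - 1) (by simpa using h)
  simp only [id] at this
  omega

lemma exists_append_singleton_eq_cons {x m : ℤ} {S U V : List ℤ} (h : x :: S = U ++ m :: V) :
    ∃ W, U ++ [m] = x :: W := by
  cases U with
  | nil => exact ⟨[], by rw [(List.cons_eq_cons.1 h).1]; rfl⟩
  | cons z U => exact ⟨U ++ [m], by rw [(List.cons_eq_cons.1 h).1]; rfl⟩

/-- A positive permutation that contains the block `[1, …, k]` is transformed into one that
contains the block `[1, …, k + 1]` by at most one context directed swap. -/
lemma exists_extend_block {n k : ℕ} (hk : 1 ≤ k) (hkn : k < n) {A C : List ℤ}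
    (hperm : (A ++ identityPerm k ++ C).Perm (identityPerm n)) {X : ℤ × ℤ → Bool}
    (hX : Colors X true (A ++ identityPerm k ++ C) false) :
    ∃ A' C', Relation.ReflGen CdsStep (A ++ identityPerm k ++ C)
      (A' ++ identityPerm (k + 1) ++ C') := by
  obtain ⟨j, rfl⟩ := Nat.exists_eq_add_of_le' hk
  have hnd := hperm.nodup_iff.2 (nodup_identityPerm n)
  have hmem : ∀ x : ℤ, x ∈ A ++ identityPerm (j + 1) ++ C ↔ 1 ≤ x ∧ x ≤ n := fun x =>
    hperm.mem_iff.trans mem_identityPerm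
  set b : ℤ := (j : ℤ) + 1 with hb
  have hb0 : 0 < b := by omega
  have hblock : identityPerm (j + 1) = identityPerm j ++ [b] := identityPerm_succ j
  have hblock' : identityPerm (j + 1 + 1) = identityPerm (j + 1) ++ [b + 1] := by
    rw [identityPerm_succ]
    simp [hb]
  have hmemb : ∀ x : ℤ, x ∈ identityPerm (j + 1) ↔ 1 ≤ x ∧ x ≤ b := fun x => by
    rw [mem_identityPerm]
    simp [hb]
  have hlow : ∀ x, x ∈ A ∨ x ∈ C → b < x := by
    intro x hx
    have h1 : 1 ≤ x := ((hmem x).1 (by simp only [List.mem_append]; tauto)).1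
    by_contra hcon
    have hxb := (hmemb x).2 ⟨h1, by omega⟩
    simp only [List.nodup_append, List.mem_append] at hnd
    rcases hx with hx | hx
    · exact hnd.1.2.2 x hx x hxb rfl
    · exact hnd.2.2 x (Or.inr hxb) x hx rfl
  have hnext : b + 1 ∈ A ++ identityPerm (j + 1) ++ C := (hmem _).2 (by omega)
  simp only [List.mem_append, hmemb] at hnext
  have hnext' : b + 1 ∈ A ∨ b + 1 ∈ C := by
    rcases hnext with (h | h) | h
    · exact Or.inl h
    · omega
    · exact Or.inr h
  rcases hnext' with h | h
  · obtain ⟨A, S, rfl⟩ := List.append_of_mem h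
    by_cases hAC : A ++ C = []
    · exfalso
      obtain ⟨rfl, rfl⟩ := List.append_eq_nil_iff.1 hAC
      have h₁ := hX.startsWith (p := (b, b + 1)) (by
        refine ⟨b + 1, S ++ identityPerm (j + 1), by simp, ?_⟩
        rw [leftPointer_of_pos (by omega)]
        simp)
      have h₂ := hX.endsWith (p := (b, b + 1)) (by
        rw [hblock, List.append_nil, ← List.append_assoc]
        exact endsWith_append_singleton hb0 _)
      rw [← h₁] at h₂
      exact absurd h₂ (by simp)
    -- With m + 1 outside the stretch from b + 1 to b and m inside it, the pointer (m,m+1)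
    -- interleaves with (b,b+1), so a swap applies; it brings b + 1 right after the block.
    obtain ⟨m', hm', hm⟩ := exists_mem_pred_notMem hAC
    obtain ⟨m, rfl⟩ : ∃ m, m' = m + 1 := ⟨m' - 1, by ring⟩
    rw [add_sub_cancel_right] at hm
    rw [List.mem_append] at hm'
    have hmb : b < m + 1 := hlow _ (by simp only [List.mem_append]; tauto)
    have hmn : m + 1 ≤ n := ((hmem (m + 1)).1 (by simp only [List.mem_append]; tauto)).2
    have hmS : m ∈ (b + 1) :: S := by
      have h₁ := (hmem m).2 (by omega)
      have h₂ : m ≠ b := by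
        rintro rfl
        simp only [List.nodup_append, List.mem_append, List.mem_cons] at hnd
        rcases hm' with h | h
        · exact hnd.1.1.2.2 _ h _ (Or.inl rfl) rfl
        · exact hnd.2.2 _ (Or.inl (Or.inr (Or.inl rfl))) _ h rfl
      simp only [List.mem_append, hmemb] at h₁ hm ⊢
      have : ¬ (1 ≤ m ∧ m ≤ b) := by omega
      tauto
    obtain ⟨U, V, hUV⟩ := List.append_of_mem hmS
    obtain ⟨W, hW⟩ := exists_append_singleton_eq_cons hUV
    have hU : StartsWith (b, b + 1) (U ++ [m]) := by
      rw [hW]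
      simpa using startsWith_cons (x := b + 1) (by omega) W
    have hUV' : (b + 1) :: S = (U ++ [m]) ++ V := by rw [hUV]; simp
    rcases hm' with h | h
    · obtain ⟨D, E, rfl⟩ := List.append_of_mem h
      refine ⟨D ++ V, W ++ (m + 1) :: E ++ C, .single ⟨(m, m + 1), (b, b + 1), ?_⟩⟩
      have := Cds.left_left (p := (m, m + 1)) (q := (b, b + 1)) D ((m + 1) :: E) (U ++ [m])
        (V ++ identityPerm (j + 1)) C (by simpa using startsWith_cons (x := m + 1) (by omega) E)
        hU (endsWith_append_singleton (by omega) _)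
        (by rw [hblock, ← List.append_assoc]; exact endsWith_append_singleton hb0 _)
      rw [hUV', hblock']
      convert this using 1
      · simp
      · rw [hW]; simp
    · obtain ⟨D, E, rfl⟩ := List.append_of_mem h
      refine ⟨A ++ D ++ V, W ++ (m + 1) :: E, .single ⟨(b, b + 1), (m, m + 1), ?_⟩⟩
      have := Cds.left_right (p := (b, b + 1)) (q := (m, m + 1)) A (U ++ [m])
        (V ++ identityPerm (j + 1)) D ((m + 1) :: E) hU (endsWith_append_singleton (by omega) _)
        (by rw [hblock, ← List.append_assoc]; exact endsWith_append_singleton hb0 _)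
        (by simpa using startsWith_cons (x := m + 1) (by omega) E)
      rw [hUV', hblock']
      convert this using 1
      · simp
      · rw [hW]; simp
  · obtain ⟨S, C, rfl⟩ := List.append_of_mem h
    by_cases hS : S = []
    · subst hS
      exact ⟨A, C, by rw [hblock']; simpa using Relation.ReflGen.refl⟩
    -- Now the block comes first: m + 1 lies between b and b + 1 while m lies outside, so the
    -- pointers interleave again.
    obtain ⟨m', hm', hm⟩ := exists_mem_pred_notMem hS
    obtain ⟨m, rfl⟩ : ∃ m, m' = m + 1 := ⟨m' - 1, by ring⟩
    rw [add_sub_cancel_right] at hm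
    have hmb : b < m + 1 := hlow _ (by simp only [List.mem_append]; tauto)
    have hmn : m + 1 ≤ n := ((hmem (m + 1)).1 (by simp only [List.mem_append]; tauto)).2
    have hmAC : m ∈ A ∨ m ∈ (b + 1) :: C := by
      have h₁ := (hmem m).2 (by omega)
      have h₂ : m ≠ b := by
        rintro rfl
        simp only [List.nodup_append, List.mem_append, List.mem_cons] at hnd
        exact hnd.2.1.2.2 _ hm' _ (Or.inl rfl) rfl
      simp only [List.mem_append, hmemb] at h₁
      have : ¬ (1 ≤ m ∧ m ≤ b) := by omega
      tauto
    obtain ⟨D, E, rfl⟩ := List.append_of_mem hm'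
    have hmE : StartsWith (m, m + 1) ((m + 1) :: E) := by
      simpa using startsWith_cons (x := m + 1) (by omega) E
    rcases hmAC with h | h
    · obtain ⟨F, G, rfl⟩ := List.append_of_mem h
      refine ⟨F ++ [m] ++ (m + 1) :: E ++ D ++ G, C, .single ⟨(m, m + 1), (b, b + 1), ?_⟩⟩
      have := Cds.right_right (p := (m, m + 1)) (q := (b, b + 1)) (F ++ [m])
        (G ++ identityPerm (j + 1)) D ((m + 1) :: E) ((b + 1) :: C)
        (endsWith_append_singleton (by omega) _)
        (by rw [hblock, ← List.append_assoc]; exact endsWith_append_singleton hb0 _)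
        hmE (by simpa using startsWith_cons (x := b + 1) (by omega) C)
      rw [hblock']
      convert this using 1 <;> simp
    · obtain ⟨U, V, hUV⟩ := List.append_of_mem h
      obtain ⟨W, hW⟩ := exists_append_singleton_eq_cons hUV
      have hUV' : (b + 1) :: C = (U ++ [m]) ++ V := by rw [hUV]; simp
      refine ⟨A, W ++ (m + 1) :: E ++ D ++ V, .single ⟨(b, b + 1), (m, m + 1), ?_⟩⟩
      have := Cds.right_left (p := (b, b + 1)) (q := (m, m + 1)) (A ++ identityPerm (j + 1))
        D ((m + 1) :: E) (U ++ [m]) V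
        (by rw [hblock, ← List.append_assoc]; exact endsWith_append_singleton hb0 _)
        hmE (by rw [hW]; simpa using startsWith_cons (x := b + 1) (by omega) W)
        (endsWith_append_singleton (by omega) _)
      rw [hUV', hblock']
      convert this using 1
      · simp
      · rw [hW]; simp

/-- Induction on `d`, the number of values still missing from the block. -/
lemma cdsSortable_of_block {n : ℕ} {X : ℤ × ℤ → Bool} (d : ℕ) :
    ∀ (k : ℕ) (A C : List ℤ), 1 ≤ k → k + d = n →
      (A ++ identityPerm k ++ C).Perm (identityPerm n) →
      Colors X true (A ++ identityPerm k ++ C) false →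
      CdsSortable n (A ++ identityPerm k ++ C) := by
  induction d with
  | zero =>
    rintro k A C - rfl hperm -
    have hlen := hperm.length_eq
    simp only [List.length_append, Nat.add_zero] at hlen
    have hA : A = [] := List.length_eq_zero_iff.1 (by omega)
    have hC : C = [] := List.length_eq_zero_iff.1 (by omega)
    subst hA hC
    simpa [CdsSortable] using Relation.ReflTransGen.refl
  | succ d ih =>
    intro k A C hk hd hperm hX
    obtain ⟨A', C', hstep⟩ := exists_extend_block hk (by omega) hperm hX
    rcases (Relation.reflGen_iff _ _ _).1 hstep with h | ⟨p, q, h⟩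
    · rw [← h] at hperm hX ⊢
      exact ih (k + 1) A' C' (by omega) (by omega) hperm hX
    · exact (ih (k + 1) A' C' (by omega) (by omega) (h.perm.trans hperm) (hX.cds h)).head ⟨p, q, h⟩

/-! ### Separable positive permutations and the main theorem -/

lemma IsSignedPerm.perm_identityPerm {n : ℕ} {l : List ℤ} (hl : IsSignedPerm n l)
    (hpos : ∀ x ∈ l, 0 < x) : l.Perm (identityPerm n) := by
  have h := List.Perm.map (fun k : ℕ => (k : ℤ)) hl
  rw [List.map_map] at h
  have hid : l.map ((fun k : ℕ => (k : ℤ)) ∘ Int.natAbs) = l := by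
    conv_rhs => rw [← List.map_id l]
    refine List.map_congr_left fun x hx => ?_
    have := hpos x hx
    simp only [Function.comp, id]
    omega
  rwa [hid] at h

lemma IsSignedPerm.cdsSortable {n : ℕ} {l : List ℤ} (hn : 1 ≤ n) (hl : IsSignedPerm n l)
    (hpos : ∀ x ∈ l, 0 < x) (hsep : Separable n l) : CdsSortable n l := by
  obtain ⟨X, -, -, hX⟩ := hsep
  have hperm := hl.perm_identityPerm hpos
  have h1 : (1 : ℤ) ∈ l := hperm.mem_iff.2 (mem_identityPerm.2 (by omega))
  obtain ⟨A, C, rfl⟩ := List.append_of_mem h1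
  have h : A ++ 1 :: C = A ++ identityPerm 1 ++ C := by simp [identityPerm]
  rw [h] at hperm hX ⊢
  exact cdsSortable_of_block (n - 1) 1 A C le_rfl (by omega) hperm hX

theorem theorem9 (n : ℕ) (π : List ℤ) (hπ : IsSignedPerm n π) (hsort : CdrSortable n π)
    (β : List ℤ) (hβ : IsCdrFixedPointOf β π) : CdsSortable n β := by
  obtain ⟨hred, hfix⟩ := hβ
  have hβperm : IsSignedPerm n β := by
    clear hfix
    induction hred with
    | refl => exact hπ
    | tail _ h ih =>
      obtain ⟨p, h⟩ := h
      exact ih.cdr h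
  -- For n = 0 the pointers (0,1) and (n,n+1) coincide and nothing is separable.
  rcases Nat.eq_zero_or_pos n with rfl | hn
  · have : β = [] := by simpa [IsSignedPerm] using hβperm
    subst this
    exact Relation.ReflTransGen.refl
  have hπsep : Separable n π := by
    clear hred
    induction hsort using Relation.ReflTransGen.head_induction_on with
    | refl => exact separable_identityPerm hn
    | head h _ ih =>
      obtain ⟨p, h⟩ := h
      exact Separable.of_cdr hπ h (ih (hπ.cdr h))
  have hβsep : IsSignedPerm n β ∧ Separable n β := by
    clear hfix hβperm
    induction hred with
    | refl => exact ⟨hπ, hπsep⟩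
    | tail _ h ih =>
      obtain ⟨p, h⟩ := h
      obtain ⟨hperm, X, h0, hn, hX⟩ := ih
      exact ⟨hperm.cdr h, X, h0, hn, hX.cdr (fun x hx => hperm.ne_zero hx) h⟩
  obtain ⟨x, hx, hx1⟩ := (hβperm.mem_iff 1).2 ⟨le_rfl, hn⟩
  have hsign : ∀ y ∈ β, (0 < x ↔ 0 < y) := fun y hy =>
    hβperm.pos_iff_pos_of_forall_not_cdr hfix hx hx1 (y.natAbs - 1) y hy
      (by have := hβperm.bounds hy; omega)
  by_cases hpos : 0 < x
  · exact hβperm.cdsSortable hn (fun y hy => (hsign y hy).1 hpos) hβsep.2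
  · refine absurd hβsep.2 (hβperm.not_separable_of_neg fun y hy => ?_)
    have h₁ := hβperm.ne_zero hy
    have h₂ := hsign y hy
    omega
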